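/- Let $n \ge 12$ be an even integer, and let $G_n$ be the simple graph obtained from the cycle $C_n$ with vertices $v_1, v_2, \dots, v_n$ in cyclic order by adding the edges $v_n v_{n/2-1}$, $v_1 v_{n-2}$, $v_{n-1} v_{n-3}$, and $v_k v_{n-2-k}$ for every integer $k$ with $2 \le k \le n/2-2$. Then $G_n$ is cubic (every vertex has degree $3$), Hamiltonian, and asymmetric: the only automorphism of $G_n$ is the identity. -/

import Mathlib

/-- The pair of labels `(a, b)` is one of the listed chords `v_a v_b` on the vertices
`v_1, …, v_n` (each chord is listed in one orientation). -/
def CubicChord (n a b : ℕ) : Prop :=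
  (a = n ∧ b = n / 2 - 1) ∨
  (a = 1 ∧ b = n - 2) ∨
  (a = n - 1 ∧ b = n - 3) ∨
  (2 ≤ a ∧ a ≤ n / 2 - 2 ∧ b = n - 2 - a)

instance CubicChord.decidable (n a b : ℕ) : Decidable (CubicChord n a b) := by
  unfold CubicChord
  infer_instance

/-- The cycle `C_n` together with the chords. The element `i : Fin n` is the vertex `v_{i+1}`,
so that `v_1, …, v_n` are `0, …, n - 1` in their cyclic order. -/
def cubicFamily (n : ℕ) : SimpleGraph (Fin n) :=
  SimpleGraph.cycleGraph n ⊔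
    SimpleGraph.fromRel (fun i j : Fin n => CubicChord n (i.val + 1) (j.val + 1))

instance cubicFamily.decidableAdj (n : ℕ) : DecidableRel (cubicFamily n).Adj := by
  unfold cubicFamily
  infer_instance

/-- A graph is asymmetric if the identity is its only automorphism. -/
def IsAsymmetricGraph {V : Type*} (G : SimpleGraph V) : Prop :=
  ∀ φ : G ≃g G, φ = SimpleGraph.Iso.refl

/-! Write n = 2m and label the vertices 0, …, 2m - 1. The chords a ~ 2m - 4 - a are rungs of a
ladder, capped by the triangle {m - 3, m - 2, m - 1} with apex m - 2; the other end carries the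
triangle {2m - 4, 2m - 3, 2m - 2}. There are no further triangles, and only from the apex m - 2 does
the opposite side continue into two more rungs (`CubicAdj.triangle_apex`), so every automorphism
fixes m - 2. Its neighbor off the triangle, 2m - 1, is then fixed, and hence 2m - 2, 0, 2m - 3 and
2m - 4. From the pair (0, 2m - 4) the ladder unrolls, each vertex having one neighbor left to go to
(`CubicAdj.eq_self_of_preserves`). Hamiltonicity is inherited from the spanning cycle. -/

/-- The cyclic arcs and the chords of the graph `cubicFamily (2 * m)`, each in one orientation, in
terms of the numerical values in `{0, …, 2 * m - 1}` of the vertices. -/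
def CubicArc (m a b : ℕ) : Prop :=
  a + 1 = b ∨ (a = 0 ∧ b + 1 = 2 * m) ∨ (a + 1 = 2 * m ∧ b + 2 = m) ∨
  (a = 0 ∧ b + 3 = 2 * m) ∨ (a + 2 = 2 * m ∧ b + 4 = 2 * m) ∨
  (1 ≤ a ∧ a + 3 ≤ m ∧ a + b + 4 = 2 * m)

/-- Adjacency of the graph `cubicFamily (2 * m)` in terms of the numerical values of the
vertices. -/
def CubicAdj (m a b : ℕ) : Prop :=
  CubicArc m a b ∨ CubicArc m b a

theorem CubicAdj.symm {m a b : ℕ} (h : CubicAdj m a b) : CubicAdj m b a :=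
  Or.symm h

theorem CubicAdj.succ {m a b : ℕ} (h : a + 1 = b) : CubicAdj m a b :=
  Or.inl (Or.inl h)

theorem CubicAdj.zero_last {m a b : ℕ} (ha : a = 0) (hb : b + 1 = 2 * m) : CubicAdj m a b :=
  Or.inl (.inr (.inl ⟨ha, hb⟩))

theorem CubicAdj.last_apex {m a b : ℕ} (ha : a + 1 = 2 * m) (hb : b + 2 = m) : CubicAdj m a b :=
  Or.inl (.inr (.inr (.inl ⟨ha, hb⟩)))

theorem CubicAdj.zero_corner {m a b : ℕ} (ha : a = 0) (hb : b + 3 = 2 * m) : CubicAdj m a b :=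
  Or.inl (.inr (.inr (.inr (.inl ⟨ha, hb⟩))))

theorem CubicAdj.corners {m a b : ℕ} (ha : a + 2 = 2 * m) (hb : b + 4 = 2 * m) : CubicAdj m a b :=
  Or.inl (.inr (.inr (.inr (.inr (.inl ⟨ha, hb⟩)))))

theorem CubicAdj.rung {m a b : ℕ} (ha : 1 ≤ a) (hb : 1 ≤ b) (hne : a ≠ b)
    (h : a + b + 4 = 2 * m) : CubicAdj m a b := by
  rcases lt_or_gt_of_ne hne with h' | h'
  · exact Or.inl (.inr (.inr (.inr (.inr (.inr ⟨ha, by omega, h⟩)))))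
  · exact Or.inr (.inr (.inr (.inr (.inr (.inr ⟨hb, by omega, by omega⟩)))))

theorem cycleGraph_adj_iff_val {n : ℕ} (hn : 2 ≤ n) (i j : Fin n) :
    (SimpleGraph.cycleGraph n).Adj i j ↔
      i.val + 1 = j.val ∨ j.val + 1 = i.val ∨ (i.val = 0 ∧ j.val + 1 = n) ∨
        (j.val = 0 ∧ i.val + 1 = n) := by
  have hi := i.isLt
  have hj := j.isLt
  rw [SimpleGraph.cycleGraph_adj']
  rcases le_total i j with h | h
  · rcases h.eq_or_lt with rfl | h'
    · have : NeZero n := ⟨by omega⟩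
      simp only [sub_self, Fin.val_zero]
      omega
    · rw [Fin.sub_val_of_le h, Fin.coe_sub_iff_lt.mpr h']
      rw [Fin.lt_def] at h'
      omega
  · rcases h.eq_or_lt with rfl | h'
    · have : NeZero n := ⟨by omega⟩
      simp only [sub_self, Fin.val_zero]
      omega
    · rw [Fin.sub_val_of_le h, Fin.coe_sub_iff_lt.mpr h']
      rw [Fin.lt_def] at h'
      omega

theorem cubicArc_iff_cubicChord {m a b : ℕ} (hm : 6 ≤ m) :
    CubicArc m a b ↔
      a + 1 = b ∨ (a = 0 ∧ b + 1 = 2 * m) ∨ CubicChord (2 * m) (a + 1) (b + 1) := by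
  have h2 : 2 * m / 2 = m := by omega
  unfold CubicChord CubicArc
  rw [h2]
  exact or_congr Iff.rfl <| or_congr Iff.rfl <|
    or_congr (by omega) (or_congr (by omega) (or_congr (by omega) (by omega)))

theorem CubicArc.ne {m a b : ℕ} (h : CubicArc m a b) : a ≠ b := by
  unfold CubicArc at h
  omega

theorem cubicFamily_adj_iff {m : ℕ} (hm : 6 ≤ m) (i j : Fin (2 * m)) :
    (cubicFamily (2 * m)).Adj i j ↔ CubicAdj m i.val j.val := by
  have h₁ := CubicArc.ne (m := m) (a := i.val) (b := j.val)
  have h₂ := fun h => (CubicArc.ne (m := m) (a := j.val) (b := i.val) h).symm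
  rw [cubicArc_iff_cubicChord hm] at h₁
  rw [cubicArc_iff_cubicChord hm] at h₂
  rw [cubicFamily, SimpleGraph.sup_adj, SimpleGraph.fromRel_adj,
    cycleGraph_adj_iff_val (by omega), Ne, Fin.ext_iff, CubicAdj,
    cubicArc_iff_cubicChord hm, cubicArc_iff_cubicChord hm]
  constructor
  · rintro ((h | h | h | h) | ⟨-, h | h⟩) <;> simp only [h, true_or, or_true, and_self]
  · rintro (h | h)
    · have hne := h₁ h
      rcases h with h | h | h
      exacts [Or.inl (.inl h), Or.inl (.inr (.inr (.inl h))), Or.inr ⟨hne, .inl h⟩]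
    · have hne := h₂ h
      rcases h with h | h | h
      exacts [Or.inl (.inr (.inl h)), Or.inl (.inr (.inr (.inr h))), Or.inr ⟨hne, .inr h⟩]

/-! ### Regularity and Hamiltonicity. -/

theorem SimpleGraph.degree_eq_three_of_adj_iff {V : Type*} [Fintype V] [DecidableEq V]
    (G : SimpleGraph V) [DecidableRel G.Adj] {v x y z : V} (hxy : x ≠ y) (hxz : x ≠ z)
    (hyz : y ≠ z) (h : ∀ w, G.Adj v w ↔ w = x ∨ w = y ∨ w = z) : G.degree v = 3 := by
  rw [← SimpleGraph.card_neighborFinset_eq_degree,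
    show G.neighborFinset v = {x, y, z} by ext w; simp [h w],
    Finset.card_eq_three.mpr ⟨x, y, z, hxy, hxz, hyz, rfl⟩]

/-- The six special cases are the ends of the three chords that are not rungs. Every other vertex
has its two cycle neighbors and its rung partner 2m - 4 - a. -/
theorem CubicAdj.exists_neighbors {m a : ℕ} (hm : 6 ≤ m) (ha : a < 2 * m) :
    ∃ x y z, x < 2 * m ∧ y < 2 * m ∧ z < 2 * m ∧ x ≠ y ∧ x ≠ z ∧ y ≠ z ∧
      ∀ b < 2 * m, CubicAdj m a b ↔ b = x ∨ b = y ∨ b = z := by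
  rcases eq_or_ne a 0 with rfl | h0
  · refine ⟨1, 2 * m - 1, 2 * m - 3, by omega, by omega, by omega, by omega, by omega,
      by omega, fun b hb => ⟨fun h => ?_, ?_⟩⟩
    · rcases h with (h | h | h | h | h | h) | (h | h | h | h | h | h) <;> omega
    · rintro (rfl | rfl | rfl)
      exacts [.succ (by omega),
        .zero_last rfl (by omega),
        .zero_corner rfl (by omega)]
  rcases eq_or_ne a (2 * m - 1) with rfl | h1
  · clear h0
    refine ⟨0, 2 * m - 2, m - 2, by omega, by omega, by omega, by omega, by omega,
      by omega, fun b hb => ⟨fun h => ?_, ?_⟩⟩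
    · rcases h with (h | h | h | h | h | h) | (h | h | h | h | h | h) <;> omega
    · rintro (rfl | rfl | rfl)
      exacts [(CubicAdj.zero_last rfl (by omega)).symm,
        (CubicAdj.succ (by omega)).symm,
        .last_apex (by omega) (by omega)]
  rcases eq_or_ne a (m - 2) with rfl | h2
  · clear h0 h1
    refine ⟨m - 1, m - 3, 2 * m - 1, by omega, by omega, by omega, by omega, by omega,
      by omega, fun b hb => ⟨fun h => ?_, ?_⟩⟩
    · rcases h with (h | h | h | h | h | h) | (h | h | h | h | h | h) <;> omega
    · rintro (rfl | rfl | rfl)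
      exacts [.succ (by omega),
        (CubicAdj.succ (by omega)).symm,
        (CubicAdj.last_apex (by omega) (by omega)).symm]
  rcases eq_or_ne a (2 * m - 3) with rfl | h3
  · clear h0 h1 h2
    refine ⟨2 * m - 2, 2 * m - 4, 0, by omega, by omega, by omega, by omega, by omega,
      by omega, fun b hb => ⟨fun h => ?_, ?_⟩⟩
    · rcases h with (h | h | h | h | h | h) | (h | h | h | h | h | h) <;> omega
    · rintro (rfl | rfl | rfl)
      exacts [.succ (by omega),
        (CubicAdj.succ (by omega)).symm,
        (CubicAdj.zero_corner rfl (by omega)).symm]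
  rcases eq_or_ne a (2 * m - 2) with rfl | h4
  · clear h0 h1 h2 h3
    refine ⟨2 * m - 1, 2 * m - 3, 2 * m - 4, by omega, by omega, by omega, by omega, by omega,
      by omega, fun b hb => ⟨fun h => ?_, ?_⟩⟩
    · rcases h with (h | h | h | h | h | h) | (h | h | h | h | h | h) <;> omega
    · rintro (rfl | rfl | rfl)
      exacts [.succ (by omega),
        (CubicAdj.succ (by omega)).symm,
        .corners (by omega) (by omega)]
  rcases eq_or_ne a (2 * m - 4) with rfl | h5
  · clear h0 h1 h2 h3 h4
    refine ⟨2 * m - 3, 2 * m - 5, 2 * m - 2, by omega, by omega, by omega, by omega, by omega,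
      by omega, fun b hb => ⟨fun h => ?_, ?_⟩⟩
    · rcases h with (h | h | h | h | h | h) | (h | h | h | h | h | h) <;> omega
    · rintro (rfl | rfl | rfl)
      exacts [.succ (by omega),
        (CubicAdj.succ (by omega)).symm,
        (CubicAdj.corners (by omega) (by omega)).symm]
  have hpos : 1 ≤ a := by omega
  have hlt : a + 4 < 2 * m := by omega
  clear h0 h1 h3 h4 h5
  refine ⟨a + 1, a - 1, 2 * m - 4 - a, by omega, by omega, by omega, by omega, by omega,
      by omega, fun b hb => ⟨fun h => ?_, ?_⟩⟩
  · rcases h with (h | h | h | h | h | h) | (h | h | h | h | h | h) <;> omega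
  · rintro (rfl | rfl | rfl)
    exacts [.succ (by omega),
      (CubicAdj.succ (by omega)).symm,
      .rung (by omega) (by omega) (by omega) (by omega)]

theorem cubicFamily_isRegularOfDegree {m : ℕ} (hm : 6 ≤ m) :
    (cubicFamily (2 * m)).IsRegularOfDegree 3 := by
  intro v
  obtain ⟨x, y, z, hx, hy, hz, hxy, hxz, hyz, h⟩ := CubicAdj.exists_neighbors hm v.isLt
  refine SimpleGraph.degree_eq_three_of_adj_iff _ (x := ⟨x, hx⟩) (y := ⟨y, hy⟩) (z := ⟨z, hz⟩)
    (by simpa using hxy) (by simpa using hxz) (by simpa using hyz) fun w => ?_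
  rw [cubicFamily_adj_iff hm, h w w.isLt]
  simp [Fin.ext_iff]

theorem cycleGraph_isHamiltonian {n : ℕ} (hn : 3 ≤ n) :
    (SimpleGraph.cycleGraph n).IsHamiltonian := by
  obtain ⟨k, rfl⟩ := Nat.exists_eq_add_of_le' hn
  intro _
  exact ⟨0, SimpleGraph.cycleGraph.cycle k,
    SimpleGraph.Walk.isHamiltonianCycle_iff_isCycle_and_length_eq.mpr
      ⟨SimpleGraph.cycleGraph.isCycle_cycle, by simp [SimpleGraph.cycleGraph.length_cycle]⟩⟩

/-! ### Triangles and the distinguished apex. -/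

/-- The only triangles are `{m - 3, m - 2, m - 1}` and `{2m - 4, 2m - 3, 2m - 2}`. -/
theorem CubicAdj.triangle {m a b c : ℕ} (hm : 6 ≤ m)
    (ha : a < 2 * m) (hb : b < 2 * m) (hc : c < 2 * m)
    (hab : CubicAdj m a b) (hbc : CubicAdj m b c) (hac : CubicAdj m a c) :
    (m ≤ a + 3 ∧ a < m ∧ m ≤ b + 3 ∧ b < m ∧ m ≤ c + 3 ∧ c < m) ∨
      (2 * m ≤ a + 4 ∧ a + 1 < 2 * m ∧ 2 * m ≤ b + 4 ∧ b + 1 < 2 * m ∧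
        2 * m ≤ c + 4 ∧ c + 1 < 2 * m) := by
  unfold CubicAdj CubicArc at *
  omega

/-- The neighbor outside its triangle of a vertex lying on a triangle. -/
theorem CubicAdj.outer_left {m x y : ℕ} (hm : 6 ≤ m) (hy : y < 2 * m) (hx : m ≤ x + 3)
    (hx' : x < m) (hxy : CubicAdj m x y) (h : y + 3 < m ∨ m ≤ y) :
    (x + 3 = m ∧ y + 4 = m) ∨ (x + 2 = m ∧ y + 1 = 2 * m) ∨ (x + 1 = m ∧ y = m) := by
  unfold CubicAdj CubicArc at hxy
  omega

theorem CubicAdj.outer_right {m x y : ℕ} (hm : 6 ≤ m) (hy : y < 2 * m) (hx : 2 * m ≤ x + 4)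
    (hx' : x + 1 < 2 * m) (hxy : CubicAdj m x y) (h : y + 4 < 2 * m ∨ y + 1 = 2 * m) :
    (x + 4 = 2 * m ∧ y + 5 = 2 * m) ∨ (x + 3 = 2 * m ∧ y = 0) ∨
      (x + 2 = 2 * m ∧ y + 1 = 2 * m) := by
  unfold CubicAdj CubicArc at hxy
  omega

theorem CubicAdj.irrefl {m a : ℕ} (hm : 6 ≤ m) : ¬ CubicAdj m a a := by
  unfold CubicAdj CubicArc
  omega

/-- The exclusions leave only q = 1 and r = m - 2, which are not adjacent: the edge between 0 and 2m
- 1 does not continue to a further rung away from the right triangle. -/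
theorem CubicAdj.not_corner_square {m q r : ℕ} (hm : 6 ≤ m)
    (hq : q < 2 * m) (hr : r < 2 * m) (h₁ : CubicAdj m 0 q) (h₂ : CubicAdj m (2 * m - 1) r)
    (hqr : CubicAdj m q r) (hq₁ : q + 3 ≠ 2 * m) (hq₂ : q + 1 ≠ 2 * m) (hr₁ : r + 2 ≠ 2 * m)
    (hr₂ : r ≠ 0) : False := by
  have hq : q = 1 := by unfold CubicAdj CubicArc at h₁; omega
  have hr : r = m - 2 := by unfold CubicAdj CubicArc at h₂; omega
  subst hq hr
  unfold CubicAdj CubicArc at hqr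
  omega

/-- The vertex `m - 2` is the only apex of a triangle whose base starts a ladder with two
further rungs. -/
theorem CubicAdj.triangle_apex {m p q r q' r' q'' r'' : ℕ} (hm : 6 ≤ m)
    (hp : p < 2 * m) (hq : q < 2 * m) (hr : r < 2 * m) (hq' : q' < 2 * m) (hr' : r' < 2 * m)
    (hq'' : q'' < 2 * m) (hr'' : r'' < 2 * m)
    (hpq : CubicAdj m p q) (hqr : CubicAdj m q r) (hpr : CubicAdj m p r)
    (hqq' : CubicAdj m q q') (hrr' : CubicAdj m r r') (hqr' : CubicAdj m q' r')
    (hqq'' : CubicAdj m q' q'') (hrr'' : CubicAdj m r' r'') (hqr'' : CubicAdj m q'' r'')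
    (h₁ : q' ≠ p) (h₂ : q' ≠ r) (h₃ : r' ≠ p) (h₄ : r' ≠ q) (h₅ : q'' ≠ q) (h₆ : q'' ≠ r')
    (h₇ : r'' ≠ r) (h₈ : r'' ≠ q') : p + 2 = m := by
  have hqr₀ : q ≠ r := by rintro rfl; exact CubicAdj.irrefl hm hqr
  have hpq₀ : p ≠ q := by rintro rfl; exact CubicAdj.irrefl hm hpq
  have hpr₀ : p ≠ r := by rintro rfl; exact CubicAdj.irrefl hm hpr
  have hq₀ : q' ≠ q := by rintro rfl; exact CubicAdj.irrefl hm hqq'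
  have hr₀ : r' ≠ r := by rintro rfl; exact CubicAdj.irrefl hm hrr'
  rcases CubicAdj.triangle hm hp hq hr hpq hqr hpr with ht | ht
  · have hoq := CubicAdj.outer_left hm hq' (by omega) (by omega) hqq' (by omega)
    have hor := CubicAdj.outer_left hm hr' (by omega) (by omega) hrr' (by omega)
    -- Among the outer neighbors m - 4, 2m - 1 and m, only m - 4 and m are adjacent; this makes m -
    -- 3 and m - 1 the base.
    unfold CubicAdj CubicArc at hqr'
    rcases hoq with hoq | hoq | hoq <;> rcases hor with hor | hor | hor <;> omega
  · have hoq := CubicAdj.outer_right hm hq' (by omega) (by omega) hqq' (by omega)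
    have hor := CubicAdj.outer_right hm hr' (by omega) (by omega) hrr' (by omega)
    -- Here the outer neighbors are 2m - 5, 0 and 2m - 1, of which only 0 and 2m - 1 are adjacent.
    have key : (q' = 0 ∧ r' = 2 * m - 1) ∨ (r' = 0 ∧ q' = 2 * m - 1) := by
      unfold CubicAdj CubicArc at hqr'
      rcases hoq with hoq | hoq | hoq <;> rcases hor with hor | hor | hor <;> omega
    exfalso
    rcases key with ⟨rfl, rfl⟩ | ⟨rfl, rfl⟩
    · exact CubicAdj.not_corner_square hm hq'' hr'' hqq'' hrr'' hqr''
        (by omega) (by omega) (by omega) (by omega)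
    · exact CubicAdj.not_corner_square hm hr'' hq'' hrr'' hqq'' hqr''.symm
        (by omega) (by omega) (by omega) (by omega)

/-! ### Rigidity: propagation along the ladder. -/

/-- Excluding 2m - 1 and 2m - 3 matters only for k = 1, where they are the other neighbors of 0; for
larger k the rung partner and the predecessor are excluded instead. -/
theorem CubicAdj.next_left {m k y : ℕ} (hk : 1 ≤ k) (hkm : k + 3 ≤ m) (h : CubicAdj m (k - 1) y)
    (h₁ : y ≠ 2 * m - 4 - (k - 1)) (h₂ : y ≠ 2 * m - 1) (h₃ : y ≠ 2 * m - 3)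
    (h₄ : 2 ≤ k → y ≠ k - 2) : y = k := by
  rcases h with (h | h | h | h | h | h) | (h | h | h | h | h | h) <;> omega

theorem CubicAdj.next_right {m k y : ℕ} (hk : 1 ≤ k) (hkm : k + 3 ≤ m)
    (h : CubicAdj m (2 * m - 4 - (k - 1)) y) (h₁ : y ≠ k - 1) (h₂ : y ≠ 2 * m - 2)
    (h₃ : y ≠ 2 * m - 3) (h₄ : 2 ≤ k → y ≠ 2 * m - 4 - (k - 2)) : y = 2 * m - 4 - k := by
  rcases h with (h | h | h | h | h | h) | (h | h | h | h | h | h) <;> omega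

/-- An injective adjacency-preserving self-map of the labels fixes every label. -/
theorem CubicAdj.eq_self_of_preserves {m : ℕ} (hm : 6 ≤ m) {f : ℕ → ℕ}
    (hlt : ∀ a < 2 * m, f a < 2 * m)
    (hinj : ∀ a b, a < 2 * m → b < 2 * m → a ≠ b → f a ≠ f b)
    (hadj : ∀ a b, a < 2 * m → b < 2 * m → CubicAdj m a b → CubicAdj m (f a) (f b)) :
    ∀ a < 2 * m, f a = a := by
  have hpq := hadj (m - 3) (m - 2) (by omega) (by omega)
    (.succ (by omega))
  have hpr := hadj (m - 2) (m - 1) (by omega) (by omega)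
    (.succ (by omega))
  have hqr := hadj (m - 3) (m - 1) (by omega) (by omega)
    (.rung (by omega) (by omega) (by omega) (by omega))
  have hqr' := hadj (m - 4) m (by omega) (by omega)
    (.rung (by omega) (by omega) (by omega) (by omega))
  -- This second rung beyond the triangle needs 1 ≤ m - 5, that is m ≥ 6.
  have hqr'' := hadj (m - 5) (m + 1) (by omega) (by omega)
    (.rung (by omega) (by omega) (by omega) (by omega))
  have hqq' := hadj (m - 4) (m - 3) (by omega) (by omega)
    (.succ (by omega))
  have hqq'' := hadj (m - 5) (m - 4) (by omega) (by omega)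
    (.succ (by omega))
  have hrr' := hadj (m - 1) m (by omega) (by omega)
    (.succ (by omega))
  have hrr'' := hadj m (m + 1) (by omega) (by omega)
    (.succ (by omega))
  have hapex : f (m - 2) + 2 = m :=
    CubicAdj.triangle_apex hm (hlt _ (by omega)) (hlt _ (by omega)) (hlt _ (by omega))
      (hlt _ (by omega)) (hlt _ (by omega)) (hlt _ (by omega)) (hlt _ (by omega))
      hpq.symm hqr hpr hqq'.symm hrr' hqr' hqq''.symm hrr'' hqr''
      (hinj _ _ (by omega) (by omega) (by omega))
      (hinj _ _ (by omega) (by omega) (by omega))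
      (hinj _ _ (by omega) (by omega) (by omega))
      (hinj _ _ (by omega) (by omega) (by omega))
      (hinj _ _ (by omega) (by omega) (by omega))
      (hinj _ _ (by omega) (by omega) (by omega))
      (hinj _ _ (by omega) (by omega) (by omega))
      (hinj _ _ (by omega) (by omega) (by omega))
  -- As m - 2 is fixed, the left triangle maps onto itself; m - 3 and m - 1 could still be swapped.
  have htri := CubicAdj.triangle hm (hlt _ (by omega)) (hlt _ (by omega)) (hlt _ (by omega))
    hpq hpr hqr
  clear hpq hpr hqr hqr' hqr'' hqq' hqq'' hrr' hrr''
  have last : f (2 * m - 1) = 2 * m - 1 := by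
    have h := hadj (m - 2) (2 * m - 1) (by omega) (by omega)
      (CubicAdj.last_apex (by omega) (by omega)).symm
    have := hinj (2 * m - 1) (m - 3) (by omega) (by omega) (by omega)
    have := hinj (2 * m - 1) (m - 1) (by omega) (by omega) (by omega)
    have := hinj (2 * m - 1) (m - 2) (by omega) (by omega) (by omega)
    have := hinj (m - 3) (m - 1) (by omega) (by omega) (by omega)
    have := hinj (m - 3) (m - 2) (by omega) (by omega) (by omega)
    have := hinj (m - 1) (m - 2) (by omega) (by omega) (by omega)
    have := hlt (2 * m - 1) (by omega)
    have := CubicAdj.outer_left hm this (by omega) (by omega) h (by omega)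
    omega
  have hn2 : f (2 * m - 2) = 2 * m - 2 := by
    have h₁ := hadj (2 * m - 2) (2 * m - 1) (by omega) (by omega) (.succ (by omega))
    -- The image is a neighbor of 2m - 1, so 0, m - 2 or 2m - 2; lying on a triangle rules out 0,
    -- and injectivity rules out m - 2.
    have h₂ := CubicAdj.triangle hm (hlt _ (by omega)) (hlt _ (by omega)) (hlt _ (by omega))
      (hadj (2 * m - 2) (2 * m - 3) (by omega) (by omega) (CubicAdj.succ (by omega)).symm)
      (hadj (2 * m - 3) (2 * m - 4) (by omega) (by omega) (CubicAdj.succ (by omega)).symm)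
      (hadj (2 * m - 2) (2 * m - 4) (by omega) (by omega) (.corners (by omega) (by omega)))
    have := hinj (2 * m - 2) (m - 2) (by omega) (by omega) (by omega)
    rw [last] at h₁
    unfold CubicAdj CubicArc at h₁
    omega
  have h0 : f 0 = 0 := by
    have h := hadj (2 * m - 1) 0 (by omega) (by omega) (CubicAdj.zero_last rfl (by omega)).symm
    have := hinj 0 (2 * m - 2) (by omega) (by omega) (by omega)
    have := hinj 0 (m - 2) (by omega) (by omega) (by omega)
    have := hlt 0 (by omega)
    rw [last] at h
    unfold CubicAdj CubicArc at h
    omega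
  have hn3 : f (2 * m - 3) = 2 * m - 3 := by
    have h₁ := hadj 0 (2 * m - 3) (by omega) (by omega) (.zero_corner rfl (by omega))
    have h₂ := hadj (2 * m - 2) (2 * m - 3) (by omega) (by omega) (CubicAdj.succ (by omega)).symm
    have := hinj (2 * m - 3) (2 * m - 1) (by omega) (by omega) (by omega)
    rw [h0] at h₁
    rw [hn2] at h₂
    unfold CubicAdj CubicArc at h₁ h₂
    omega
  have hn4 : f (2 * m - 4) = 2 * m - 4 := by
    have h₁ := hadj (2 * m - 2) (2 * m - 4) (by omega) (by omega) (.corners (by omega) (by omega))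
    have := hinj (2 * m - 4) (2 * m - 1) (by omega) (by omega) (by omega)
    have := hinj (2 * m - 4) (2 * m - 3) (by omega) (by omega) (by omega)
    rw [hn2] at h₁
    unfold CubicAdj CubicArc at h₁
    omega
  -- The pair for k = 0 is not a rung. The induction moves along cycle edges, with all other
  -- neighbors already fixed.
  have ladder : ∀ k, k + 3 ≤ m → f k = k ∧ f (2 * m - 4 - k) = 2 * m - 4 - k := by
    intro k
    induction k using Nat.strong_induction_on with
    | _ k ih =>
    intro hk
    rcases Nat.eq_zero_or_pos k with rfl | hk0
    · exact ⟨h0, hn4⟩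
    obtain ⟨ih₁, ih₂⟩ := ih (k - 1) (by omega) (by omega)
    have h₁ := hadj (k - 1) k (by omega) (by omega) (.succ (by omega))
    have h₂ := hadj (2 * m - 4 - (k - 1)) (2 * m - 4 - k) (by omega) (by omega)
      (CubicAdj.succ (by omega)).symm
    rw [ih₁] at h₁
    rw [ih₂] at h₂
    have avoid : ∀ a b, a < 2 * m → b < 2 * m → f b = b → a ≠ b → f a ≠ b :=
      fun a b ha hb hfb hab h => hinj a b ha hb hab (h.trans hfb.symm)
    constructor
    · refine CubicAdj.next_left hk0 hk h₁
        (avoid _ _ (by omega) (by omega) ih₂ (by omega))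
        (avoid _ _ (by omega) (by omega) last (by omega))
        (avoid _ _ (by omega) (by omega) hn3 (by omega)) fun hk2 =>
        avoid _ _ (by omega) (by omega) (ih (k - 2) (by omega) (by omega)).1 (by omega)
    · refine CubicAdj.next_right hk0 hk h₂
        (avoid _ _ (by omega) (by omega) ih₁ (by omega))
        (avoid _ _ (by omega) (by omega) hn2 (by omega))
        (avoid _ _ (by omega) (by omega) hn3 (by omega)) fun hk2 =>
        avoid _ _ (by omega) (by omega) (ih (k - 2) (by omega) (by omega)).2 (by omega)
  intro a ha
  rcases lt_or_ge a (m - 2) with h | h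
  · exact (ladder a (by omega)).1
  rcases eq_or_ne a (m - 2) with rfl | h'
  · omega
  rcases lt_or_ge a (2 * m - 3) with h'' | h''
  · have := (ladder (2 * m - 4 - a) (by omega)).2
    rwa [show 2 * m - 4 - (2 * m - 4 - a) = a by omega] at this
  obtain rfl | rfl | rfl : a = 2 * m - 3 ∨ a = 2 * m - 2 ∨ a = 2 * m - 1 := by omega
  · exact hn3
  · exact hn2
  · exact last

theorem cubicFamily_isAsymmetricGraph {m : ℕ} (hm : 6 ≤ m) :
    IsAsymmetricGraph (cubicFamily (2 * m)) := by
  intro φ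
  have key := CubicAdj.eq_self_of_preserves hm
    -- The value outside the label range is arbitrary.
    (f := fun a => if h : a < 2 * m then (φ ⟨a, h⟩).val else a)
    (fun a ha => by simp only [ha, dif_pos]; exact (φ ⟨a, ha⟩).isLt)
    (fun a b ha hb hab => by
      simpa only [ha, hb, dif_pos, ne_eq, ← Fin.ext_iff, φ.injective.eq_iff, Fin.mk.injEq]
        using hab)
    (fun a b ha hb hab => by
      simp only [ha, hb, dif_pos]
      rw [← cubicFamily_adj_iff hm, φ.map_adj_iff, cubicFamily_adj_iff hm]
      exact hab)
  ext i
  have := key i.val i.isLt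
  simp only [i.isLt, dif_pos] at this
  exact this

theorem mainTheorem2 (n : ℕ) (hn : 12 ≤ n) (heven : Even n) :
    (cubicFamily n).IsRegularOfDegree 3 ∧
      (cubicFamily n).IsHamiltonian ∧
      IsAsymmetricGraph (cubicFamily n) := by
  obtain ⟨m, rfl⟩ := heven.exists_two_nsmul
  have hm : 6 ≤ m := by simp only [smul_eq_mul] at hn; omega
  exact ⟨cubicFamily_isRegularOfDegree hm,
    (cycleGraph_isHamiltonian (by omega)).mono le_sup_left, cubicFamily_isAsymmetricGraph hm⟩
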